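/- Let $K$ be a finite regular cell complex (a finite Hausdorff CW complex each of whose characteristic maps is a homeomorphism from a closed ball onto the corresponding closed cell, the boundary of each cell being a union of closed cells). A cell of $K$ is called maximal if its closed cell is not contained in the closed cell of any other cell. A topological shelling of $K$ is a total ordering $C_1, C_2, \ldots, C_k$ of the maximal (closed) cells of $K$ such that $$\dim(C_1) \ge \dim(C_2) \ge \cdots \ge \dim(C_k)$$ and, for each $j > 1$, at least one of the following holds: (a) $\left(\bigcup_{i<j} C_i\right) \cap C_j$ is a (non-empty) contractible subset of the boundary $\partial(C_j)$; (b) $\left(\bigcup_{i<j} C_i\right) \cap C_j = \partial(C_j)$, where $\partial(C_j) \cong S^{\dim(C_j)-1}$. Let $n \ge 0$. If $K$ admits a topological shelling and $K$ is pure $n$-dimensional, i.e. $K$ is non-empty and all its maximal cells have the same dimension $n$, then $K$ is $(n-1)$-connected; that is, $K$ is non-empty and, for every $0 \le i \le n-1$, every continuous map $S^i \to K$ extends to a continuous map $B^{i+1} \to K$ of the closed ball. -/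

import Mathlib

open Metric Set

namespace CellShelling

/-- A topological space `X` is `k`-connected (`k ≥ -1`) if it is nonempty and, for every
`0 ≤ i ≤ k`, each continuous map from the unit sphere `S^i` of `ℝ^(i+1)` to `X` extends
continuously to the closed unit ball `B^(i+1)`. For `k < -1` there is no condition. -/
def IsKConnected (k : ℤ) (X : Type*) [TopologicalSpace X] : Prop :=
  (-1 ≤ k → Nonempty X) ∧
    ∀ i : ℕ, (i : ℤ) ≤ k →
      ∀ f : C(sphere (0 : EuclideanSpace ℝ (Fin (i + 1))) 1, X),
        ∃ g : C(closedBall (0 : EuclideanSpace ℝ (Fin (i + 1))) 1, X),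
          ∀ x : sphere (0 : EuclideanSpace ℝ (Fin (i + 1))) 1,
            g ⟨x, sphere_subset_closedBall x.2⟩ = f x

section Complex

open Topology.CWComplex

variable {X : Type*} [TopologicalSpace X] (K : Set X) [Topology.CWComplex K]

/-- A cell complex is regular if each characteristic map is injective on the whole closed ball and
the boundary of each cell is a union of closed cells. As the closed ball is compact and the complex
is Hausdorff, each characteristic map is then a homeomorphism from the closed ball to the closed
cell, and from the sphere to the boundary of the cell. -/
def IsRegular : Prop :=
  ∀ (n : ℕ) (e : cell K n),
    InjOn (map (C := K) n e) (closedBall 0 1) ∧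
      ∃ S : Set (Σ m, cell K m),
        cellFrontier (C := K) n e = ⋃ c ∈ S, closedCell (C := K) c.1 c.2

/-- The maximal cells of a cell complex: the cells (recorded with their dimension) whose closed
cell is not contained in the closed cell of any other cell. -/
def MaximalCell : Type _ :=
  {e : Σ n, cell K n //
    ∀ e' : Σ n, cell K n, closedCell (C := K) e.1 e.2 ⊆ closedCell (C := K) e'.1 e'.2 → e' = e}

variable {K}

/-- The dimension of a maximal cell. -/
def MaximalCell.dim (e : MaximalCell K) : ℕ := e.1.1

/-- The closed cell, as a subset of the ambient space. -/
def MaximalCell.closed (e : MaximalCell K) : Set X := closedCell (C := K) e.1.1 e.1.2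

/-- The boundary of a maximal cell, i.e. the image of the unit sphere. -/
def MaximalCell.boundary (e : MaximalCell K) : Set X := cellFrontier (C := K) e.1.1 e.1.2

/-- `(⋃_{i < j} C_i) ∩ C_j` for an ordering `C` of the maximal cells. -/
def attachingSet {k : ℕ} (C : Fin k ≃ MaximalCell K) (j : Fin k) : Set X :=
  (⋃ i : Fin k, ⋃ _ : i < j, (C i).closed) ∩ (C j).closed

/-- A total ordering `C` of the maximal cells is a topological shelling if the dimensions are
weakly decreasing and every cell `C j` but the first meets the union of the earlier ones
either in a (nonempty) contractible subset of its boundary or in its whole boundary. -/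
def IsTopologicalShelling {k : ℕ} (C : Fin k ≃ MaximalCell K) : Prop :=
  (∀ i j : Fin k, i ≤ j → (C j).dim ≤ (C i).dim) ∧
    ∀ j : Fin k, 0 < (j : ℕ) →
      (attachingSet C j ⊆ (C j).boundary ∧ ContractibleSpace (attachingSet C j)) ∨
        attachingSet C j = (C j).boundary

variable (K)

/-- The complex has a topological shelling. -/
def AdmitsTopologicalShelling : Prop :=
  ∃ (k : ℕ) (C : Fin k ≃ MaximalCell K), IsTopologicalShelling C

/-- The complex is pure `n`-dimensional: it has a cell of dimension `n` (so it is not empty), and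
all its maximal cells have dimension `n`. -/
def IsPureOfDim (n : ℕ) : Prop :=
  Nonempty (cell K n) ∧ ∀ e : MaximalCell K, e.dim = n

end Complex

end CellShelling

namespace CellShelling

section Extensor

variable {W X : Type*} [MetricSpace W] [TopologicalSpace X]

open Classical in
/-- Two maps which are continuous on relatively closed pieces and agree on the overlap glue to a
continuous map. -/
theorem continuousOn_piecewise_of_isClosed {W X : Type*} [TopologicalSpace W] [TopologicalSpace X]
    {f g : W → X} {O F G : Set W} (hF : IsClosed F)
    (hG : IsClosed G) (hf : ContinuousOn f (O ∩ F)) (hg : ContinuousOn g (O ∩ G))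
    (hfg : EqOn f g (O ∩ (F ∩ G))) (hO : O ⊆ F ∪ G) :
    ContinuousOn (F.piecewise f g) O := by
  have h1 : ContinuousOn (F.piecewise f g) (O ∩ F) :=
    hf.congr fun x hx => piecewise_eq_of_mem _ _ _ hx.2
  have h2 : ContinuousOn (F.piecewise f g) (O ∩ G) := by
    refine hg.congr fun x hx => ?_
    by_cases hxF : x ∈ F
    · rw [piecewise_eq_of_mem _ _ _ hxF]; exact hfg ⟨hx.1, hxF, hx.2⟩
    · exact piecewise_eq_of_notMem _ _ _ hxF
  have hun : O = (O ∩ F) ∪ (O ∩ G) := by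
    rw [← inter_union_distrib_left]; exact (inter_eq_left.2 hO).symm
  rw [hun]
  intro x hx
  have hxO : x ∈ O := hx.elim (·.1) (·.1)
  have key : ∀ H : Set W, IsClosed H → ContinuousOn (F.piecewise f g) (O ∩ H) →
      ContinuousWithinAt (F.piecewise f g) (O ∩ H) x := by
    intro H hH hc
    by_cases hxH : x ∈ H
    · exact hc x ⟨hxO, hxH⟩
    · refine continuousWithinAt_of_notMem_closure fun h => hxH ?_
      exact closure_minimal inter_subset_right hH h
  exact (key F hF h1).union (key G hG h2)

/-- `S` is a neighbourhood extensor for `W`: a continuous map from a closed subset of `W` to `S`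
extends to a neighbourhood. -/
def IsNbhdExtensor (W : Type*) {X : Type*} [TopologicalSpace W] [TopologicalSpace X]
    (S : Set X) : Prop :=
  ∀ (Z : Set W) (φ : W → X), IsClosed Z → ContinuousOn φ Z → MapsTo φ Z S →
    ∃ (U : Set W) (ψ : W → X), IsOpen U ∧ Z ⊆ U ∧ ContinuousOn ψ U ∧ MapsTo ψ U S ∧ EqOn ψ φ Z

theorem isNbhdExtensor_empty : IsNbhdExtensor W (∅ : Set X) := by
  intro Z φ _ _ hm
  have : Z = ∅ := eq_empty_of_forall_notMem fun z hz => hm hz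
  subst this
  exact ⟨∅, φ, isOpen_empty, subset_rfl, continuousOn_empty _, mapsTo_empty _ _, fun _ h => h.elim⟩

/-- Two closed subsets of a metric space extend to a closed cover of the space. -/
theorem exists_isClosed_cover {Z₁ Z₂ : Set W} (h₁ : IsClosed Z₁) (h₂ : IsClosed Z₂) :
    ∃ W₁ W₂ : Set W, IsClosed W₁ ∧ IsClosed W₂ ∧ W₁ ∪ W₂ = univ ∧ Z₁ ⊆ W₁ ∧ Z₂ ⊆ W₂ ∧
      Z₂ ∩ W₁ ⊆ Z₁ ∧ Z₁ ∩ W₂ ⊆ Z₂ := by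
  refine ⟨{x | infEDist x Z₁ ≤ infEDist x Z₂}, {x | infEDist x Z₂ ≤ infEDist x Z₁},
    isClosed_le continuous_infEDist continuous_infEDist,
    isClosed_le continuous_infEDist continuous_infEDist,
    eq_univ_of_forall fun x => le_total (infEDist x Z₁) (infEDist x Z₂), ?_, ?_, ?_, ?_⟩
  · intro x hx; simp [infEDist_zero_of_mem hx]
  · intro x hx; simp [infEDist_zero_of_mem hx]
  · rintro x ⟨hx, hx'⟩
    rw [mem_ofPred_eq, infEDist_zero_of_mem hx, nonpos_iff_eq_zero] at hx'
    rwa [mem_iff_infEDist_zero_of_closed h₁]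
  · rintro x ⟨hx, hx'⟩
    rw [mem_ofPred_eq, infEDist_zero_of_mem hx, nonpos_iff_eq_zero] at hx'
    rwa [mem_iff_infEDist_zero_of_closed h₂]

open Classical in
/-- If `Z ∪ V` is closed and maps on `Z` and `V` agree on the overlap, the glued map extends. -/
theorem IsNbhdExtensor.exists_extension_union {S : Set X} (hS : IsNbhdExtensor W S)
    {Z V : Set W} {φ ψ : W → X} (hZ : IsClosed Z) (hV : IsClosed V) (hφ : ContinuousOn φ Z)
    (hψ : ContinuousOn ψ V) (hφS : MapsTo φ Z S) (hψS : MapsTo ψ V S) (h : EqOn φ ψ (Z ∩ V)) :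
    ∃ (U : Set W) (χ : W → X), IsOpen U ∧ Z ⊆ U ∧ V ⊆ U ∧ ContinuousOn χ U ∧ MapsTo χ U S ∧
      EqOn χ φ Z ∧ EqOn χ ψ V := by
  have hV' : EqOn (Z.piecewise φ ψ) ψ V := by
    intro x hx
    by_cases hxZ : x ∈ Z
    · rw [piecewise_eq_of_mem _ _ _ hxZ]; exact h ⟨hxZ, hx⟩
    · exact piecewise_eq_of_notMem _ _ _ hxZ
  have hZ' : EqOn (Z.piecewise φ ψ) φ Z := fun x hx => piecewise_eq_of_mem _ _ _ hx
  obtain ⟨U, χ, hU, hZU, hχ, hχS, he⟩ := hS (Z ∪ V) (Z.piecewise φ ψ) (hZ.union hV)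
    ((hφ.congr hZ').union_of_isClosed (hψ.congr hV') hZ hV)
    (by
      rintro x (hx | hx)
      · rw [hZ' hx]; exact hφS hx
      · rw [hV' hx]; exact hψS hx)
  exact ⟨U, χ, hU, subset_union_left.trans hZU, subset_union_right.trans hZU, hχ, hχS,
    fun x hx => (he (.inl hx)).trans (hZ' hx), fun x hx => (he (.inr hx)).trans (hV' hx)⟩

open Classical in
/-- Borsuk's union theorem for neighbourhood extensors. -/
theorem IsNbhdExtensor.union {S₁ S₂ : Set X} (hc₁ : IsClosed S₁) (hc₂ : IsClosed S₂)
    (h₁ : IsNbhdExtensor W S₁) (h₂ : IsNbhdExtensor W S₂) (h₀ : IsNbhdExtensor W (S₁ ∩ S₂)) :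
    IsNbhdExtensor W (S₁ ∪ S₂) := by
  intro Z φ hZ hφ hm
  have hZ₁ : IsClosed (Z ∩ φ ⁻¹' S₁) := hφ.preimage_isClosed_of_isClosed hZ hc₁
  have hZ₂ : IsClosed (Z ∩ φ ⁻¹' S₂) := hφ.preimage_isClosed_of_isClosed hZ hc₂
  obtain ⟨W₁, W₂, hW₁, hW₂, hW, hZW₁, hZW₂, hZ21, hZ12⟩ := exists_isClosed_cover hZ₁ hZ₂
  obtain ⟨U₀, ψ₀, hU₀, hZU₀, hψ₀, hψS₀, he₀⟩ := h₀ (Z ∩ φ ⁻¹' S₁ ∩ (Z ∩ φ ⁻¹' S₂)) φ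
    (hZ₁.inter hZ₂) (hφ.mono (inter_subset_left.trans inter_subset_left))
    (fun x hx => ⟨hx.1.2, hx.2.2⟩)
  obtain ⟨V, hV, hZV, hVU⟩ := normal_exists_closure_subset (hZ₁.inter hZ₂) hU₀ hZU₀
  have hV₀ : IsClosed (closure V ∩ (W₁ ∩ W₂)) := isClosed_closure.inter (hW₁.inter hW₂)
  have hψ₀' := hψ₀.mono (inter_subset_left.trans hVU : closure V ∩ (W₁ ∩ W₂) ⊆ U₀)
  obtain ⟨U₁, ψ₁, hU₁, hZU₁, hVU₁, hψ₁, hψS₁, he₁, hv₁⟩ := h₁.exists_extension_union hZ₁ hV₀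
    (hφ.mono inter_subset_left) hψ₀' (fun x hx => hx.2) (fun x hx => (hψS₀ (hVU hx.1)).1)
    (fun x hx => (he₀ ⟨hx.1, hZ12 ⟨hx.1, hx.2.2.2⟩⟩).symm)
  obtain ⟨U₂, ψ₂, hU₂, hZU₂, hVU₂, hψ₂, hψS₂, he₂, hv₂⟩ := h₂.exists_extension_union hZ₂ hV₀
    (hφ.mono inter_subset_left) hψ₀' (fun x hx => hx.2) (fun x hx => (hψS₀ (hVU hx.1)).2)
    (fun x hx => (he₀ ⟨hZ21 ⟨hx.1, hx.2.2.1⟩, hx.1⟩).symm)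
  have hcov : ∀ x, x ∈ W₁ ∨ x ∈ W₂ := fun x => (hW.symm ▸ mem_univ x : x ∈ W₁ ∪ W₂)
  refine ⟨(U₁ ∪ W₁ᶜ) ∩ (U₂ ∪ W₂ᶜ) ∩ (V ∪ (W₁ ∩ W₂)ᶜ), W₁.piecewise ψ₁ ψ₂, ?_, ?_, ?_, ?_, ?_⟩
  · exact ((hU₁.union hW₁.isOpen_compl).inter (hU₂.union hW₂.isOpen_compl)).inter
      (hV.union (hW₁.inter hW₂).isOpen_compl)
  · intro z hz
    have a₁ : z ∈ W₁ → z ∈ Z ∩ φ ⁻¹' S₁ := fun hw => by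
      rcases hm hz with h | h
      · exact ⟨hz, h⟩
      · exact hZ21 ⟨⟨hz, h⟩, hw⟩
    have a₂ : z ∈ W₂ → z ∈ Z ∩ φ ⁻¹' S₂ := fun hw => by
      rcases hm hz with h | h
      · exact hZ12 ⟨⟨hz, h⟩, hw⟩
      · exact ⟨hz, h⟩
    refine ⟨⟨?_, ?_⟩, ?_⟩
    · by_cases hw : z ∈ W₁
      exacts [.inl (hZU₁ (a₁ hw)), .inr hw]
    · by_cases hw : z ∈ W₂
      exacts [.inl (hZU₂ (a₂ hw)), .inr hw]
    · by_cases hw : z ∈ W₁ ∩ W₂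
      exacts [.inl (hZV ⟨a₁ hw.1, a₂ hw.2⟩), .inr hw]
  · refine continuousOn_piecewise_of_isClosed hW₁ hW₂ (hψ₁.mono ?_) (hψ₂.mono ?_) ?_ ?_
    · rintro x ⟨⟨⟨h, -⟩, -⟩, hx⟩; exact h.resolve_right (not_not.2 hx)
    · rintro x ⟨⟨⟨-, h⟩, -⟩, hx⟩; exact h.resolve_right (not_not.2 hx)
    · rintro x ⟨⟨-, h⟩, hx⟩
      have hx' : x ∈ closure V ∩ (W₁ ∩ W₂) :=
        ⟨subset_closure (h.resolve_right (not_not.2 hx)), hx⟩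
      rw [hv₁ hx', hv₂ hx']
    · rw [hW]; exact subset_univ _
  · rintro x ⟨⟨hx₁, hx₂⟩, -⟩
    by_cases hw : x ∈ W₁
    · rw [piecewise_eq_of_mem _ _ _ hw]
      exact .inl (hψS₁ (hx₁.resolve_right (not_not.2 hw)))
    · rw [piecewise_eq_of_notMem _ _ _ hw]
      exact .inr (hψS₂ (hx₂.resolve_right (not_not.2 ((hcov x).resolve_left hw))))
  · intro z hz
    by_cases hw : z ∈ W₁
    · rw [piecewise_eq_of_mem _ _ _ hw]
      refine he₁ ?_
      rcases hm hz with h | h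
      · exact ⟨hz, h⟩
      · exact hZ21 ⟨⟨hz, h⟩, hw⟩
    · rw [piecewise_eq_of_notMem _ _ _ hw]
      refine he₂ ?_
      rcases hm hz with h | h
      · exact hZ12 ⟨⟨hz, h⟩, (hcov z).resolve_left hw⟩
      · exact ⟨hz, h⟩

end Extensor

section Chart

variable {X : Type*} [TopologicalSpace X]

/-- A homeomorphism from the unit ball of `ℝⁿ` with the supremum norm to a subset `D`, given by a
map and its inverse. -/
structure BallChart (n : ℕ) (D : Set X) where
  /-- The homeomorphism. -/
  toFun : (Fin n → ℝ) → X
  /-- The inverse homeomorphism. -/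
  invFun : X → (Fin n → ℝ)
  continuousOn_toFun : ContinuousOn toFun (closedBall 0 1)
  continuousOn_invFun : ContinuousOn invFun D
  mapsTo_toFun : MapsTo toFun (closedBall 0 1) D
  mapsTo_invFun : MapsTo invFun D (closedBall 0 1)
  left_inv : ∀ v ∈ closedBall (0 : Fin n → ℝ) 1, invFun (toFun v) = v
  right_inv : ∀ x ∈ D, toFun (invFun x) = x

/-- An injective continuous image of the ball in a Hausdorff space is a chart. -/
theorem BallChart.exists_of_injOn [T2Space X] {n : ℕ} {χ : (Fin n → ℝ) → X}
    (hc : ContinuousOn χ (closedBall 0 1)) (hi : InjOn χ (closedBall 0 1)) :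
    ∃ c : BallChart n (χ '' closedBall 0 1), c.toFun = χ := by
  have hr : ∀ x ∈ χ '' closedBall 0 1, χ (Function.invFunOn χ (closedBall 0 1) x) = x :=
    fun x hx => Function.invFunOn_eq hx
  have hm : MapsTo (Function.invFunOn χ (closedBall 0 1)) (χ '' closedBall 0 1)
    (closedBall 0 1) := fun x hx => Function.invFunOn_mem hx
  refine ⟨⟨χ, Function.invFunOn χ (closedBall 0 1), hc, ?_, mapsTo_image _ _, hm,
    fun v hv => hi (hm (mem_image_of_mem _ hv)) hv (hr _ (mem_image_of_mem _ hv)), hr⟩, rfl⟩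
  rw [continuousOn_iff_isClosed]
  intro F hF
  refine ⟨χ '' (closedBall 0 1 ∩ F), ?_, ?_⟩
  · exact (((isCompact_closedBall _ _).inter_right hF).image_of_continuousOn
      (hc.mono inter_subset_left)).isClosed
  · ext x
    constructor
    · rintro ⟨hx, hxD⟩
      exact ⟨⟨_, ⟨hm hxD, hx⟩, hr x hxD⟩, hxD⟩
    · rintro ⟨⟨v, ⟨hv, hvF⟩, rfl⟩, hxD⟩
      refine ⟨?_, hxD⟩
      rwa [mem_preimage, hi (hm hxD) hv (hr _ hxD)]

variable {W : Type*} [TopologicalSpace W] [NormalSpace W]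

/-- The Tietze extension theorem for maps into the unit ball of `ℝⁿ`. -/
theorem exists_continuous_extension_closedBall {n : ℕ} {Z : Set W} (hZ : IsClosed Z)
    {φ : W → (Fin n → ℝ)} (hφ : ContinuousOn φ Z) (hm : MapsTo φ Z (closedBall 0 1)) :
    ∃ ψ : C(W, Fin n → ℝ), (∀ w, ψ w ∈ closedBall (0 : Fin n → ℝ) 1) ∧ EqOn ψ φ Z := by
  have key : ∀ i : Fin n, ∃ g : C(W, ℝ), (∀ x, g x ∈ Icc (-1 : ℝ) 1) ∧
      g.restrict Z = ⟨Z.domRestrict fun w => φ w i,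
        continuousOn_iff_continuous_domRestrict.1 ((continuous_apply i).comp_continuousOn hφ)⟩ := by
    intro i
    refine ContinuousMap.exists_restrict_eq_forall_mem_of_closed _ (fun w => ?_) ⟨0, by simp⟩ hZ
    have := hm w.2
    rw [mem_closedBall_zero_iff] at this
    have := (norm_le_pi_norm (φ w) i).trans this
    exact abs_le.1 this
  choose g hg hgr using key
  refine ⟨⟨fun w i => g i w, by fun_prop⟩, fun w => ?_, fun z hz => ?_⟩
  · rw [mem_closedBall_zero_iff, pi_norm_le_iff_of_nonneg zero_le_one]
    exact fun i => abs_le.2 (hg i w)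
  · funext i
    exact DFunLike.congr_fun (hgr i) ⟨z, hz⟩

theorem BallChart.isNbhdExtensor {n : ℕ} {D : Set X} (c : BallChart n D) :
    IsNbhdExtensor W D := by
  intro Z φ hZ hφ hm
  obtain ⟨ψ, hψ, he⟩ := exists_continuous_extension_closedBall hZ
    (c.continuousOn_invFun.comp hφ hm) (c.mapsTo_invFun.comp hm)
  refine ⟨univ, fun w => c.toFun (ψ w), isOpen_univ, subset_univ _,
    c.continuousOn_toFun.comp ψ.continuous.continuousOn fun w _ => hψ w,
    fun w _ => c.mapsTo_toFun (hψ w), fun z hz => ?_⟩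
  change c.toFun (ψ z) = φ z
  rw [he hz]
  exact c.right_inv _ (hm hz)

end Chart

section Subcomplex

open Topology.CWComplex

variable {X : Type*} [TopologicalSpace X] (K : Set X) [Topology.CWComplex K]

/-- A subset of a cell complex is a union of cells, each together with its closed cell. -/
def IsSubcomplex (S : Set X) : Prop :=
  S ⊆ K ∧ ∀ (n : ℕ) (e : cell K n), (openCell n e ∩ S).Nonempty → closedCell n e ⊆ S

variable {K}

theorem IsSubcomplex.inter {S T : Set X} (hS : IsSubcomplex K S) (hT : IsSubcomplex K T) :
    IsSubcomplex K (S ∩ T) :=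
  ⟨inter_subset_left.trans hS.1, fun n e h => subset_inter
    (hS.2 n e (h.mono (by grind))) (hT.2 n e (h.mono (by grind)))⟩

theorem IsSubcomplex.iUnion {ι : Sort*} {S : ι → Set X} (hS : ∀ i, IsSubcomplex K (S i)) :
    IsSubcomplex K (⋃ i, S i) := by
  refine ⟨iUnion_subset fun i => (hS i).1, fun n e h => ?_⟩
  rw [inter_iUnion, nonempty_iUnion] at h
  obtain ⟨i, hi⟩ := h
  exact ((hS i).2 n e hi).trans (subset_iUnion S i)

theorem eq_or_openCell_inter_cellFrontier {n m : ℕ} {e : cell K n} {e' : cell K m}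
    (h : (openCell n e ∩ closedCell m e').Nonempty) :
    (⟨n, e⟩ : Σ n, cell K n) = ⟨m, e'⟩ ∨ (openCell n e ∩ cellFrontier m e').Nonempty := by
  by_contra! hn
  rw [← cellFrontier_union_openCell_eq_closedCell, inter_union_distrib_left, hn.2,
    empty_union] at h
  obtain ⟨x, hx, hx'⟩ := h
  exact (disjoint_openCell_of_ne hn.1).le_bot ⟨hx, hx'⟩

/-- Every subcomplex is the union of its closed cells. -/
theorem IsSubcomplex.eq_iUnion {S : Set X} (hS : IsSubcomplex K S) :
    S = ⋃ c : Σ n, cell K n, ⋃ _ : (openCell (C := K) c.1 c.2 ∩ S).Nonempty,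
      closedCell (C := K) c.1 c.2 := by
  apply subset_antisymm
  · intro x hx
    have := hS.1 hx
    rw [← iUnion_openCell_eq_complex (C := K)] at this
    simp only [mem_iUnion] at this ⊢
    obtain ⟨n, e, hxe⟩ := this
    exact ⟨⟨n, e⟩, ⟨x, hxe, hx⟩, openCell_subset_closedCell n e hxe⟩
  · exact iUnion₂_subset fun c hc => hS.2 c.1 c.2 hc

variable [T2Space X]

theorem dim_lt_of_openCell_inter_cellFrontier {n m : ℕ} {e : cell K n} {e' : cell K m}
    (h : (openCell n e ∩ cellFrontier m e').Nonempty) : n < m := by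
  by_contra! hle
  obtain ⟨x, hx, hx'⟩ := h
  exact (Topology.RelCWComplex.disjoint_skeletonLT_openCell (C := K) (n := (m : ℕ∞)) (j := e)
    (by exact_mod_cast hle)).le_bot
    ⟨Topology.RelCWComplex.cellFrontier_subset_skeletonLT m e' hx', hx⟩

theorem dim_lt_of_closedCell_subset {c c' : Σ n, cell K n} (hne : c ≠ c')
    (h : (openCell (C := K) c.1 c.2 ∩ closedCell (C := K) c'.1 c'.2).Nonempty) : c.1 < c'.1 :=
  dim_lt_of_openCell_inter_cellFrontier ((eq_or_openCell_inter_cellFrontier h).resolve_left hne)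

theorem IsRegular.isSubcomplex_closedCell (hK : IsRegular K) (m : ℕ) (e' : cell K m) :
    IsSubcomplex K (closedCell m e') := by
  induction m using Nat.strong_induction_on with
  | _ m ih =>
    refine ⟨closedCell_subset_complex m e', fun n e h => ?_⟩
    rcases eq_or_openCell_inter_cellFrontier h with h | h
    · cases h; rfl
    · obtain ⟨S, hS⟩ := (hK m e').2
      rw [hS, inter_iUnion₂] at h
      simp only [nonempty_iUnion] at h
      obtain ⟨c, hc, h⟩ := h
      have hcs : closedCell (C := K) c.1 c.2 ⊆ cellFrontier m e' := by
        rw [hS]; exact subset_biUnion_of_mem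
            (u := fun c : Σ m, cell K m => closedCell (C := K) c.1 c.2) hc
      have hlt : c.1 < m := by
        refine dim_lt_of_openCell_inter_cellFrontier (e := c.2) (e' := e') ?_
        exact ⟨_, map_zero_mem_openCell c.1 c.2, hcs (map_zero_mem_closedCell c.1 c.2)⟩
      exact ((ih c.1 hlt c.2).2 n e h).trans (hcs.trans (cellFrontier_subset_closedCell m e'))

theorem IsRegular.exists_ballChart (hK : IsRegular K) (n : ℕ) (e : cell K n) :
    ∃ c : BallChart n (closedCell n e), c.toFun = map n e :=
  BallChart.exists_of_injOn (continuousOn n e) (hK n e).1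

variable [Topology.RelCWComplex.Finite K]

theorem IsSubcomplex.isClosed {S : Set X} (hS : IsSubcomplex K S) : IsClosed S := by
  have := Topology.RelCWComplex.finite_cells_of_finite (C := K)
  rw [hS.eq_iUnion]
  exact isClosed_iUnion_of_finite fun c => isClosed_iUnion_of_finite fun _ => isClosed_closedCell

/-- Subcomplexes of finite regular complexes are absolute neighbourhood extensors. -/
theorem IsSubcomplex.isNbhdExtensor (hK : IsRegular K) {W : Type*} [MetricSpace W] {S : Set X}
    (hS : IsSubcomplex K S) : IsNbhdExtensor W S := by
  have hfin := Topology.RelCWComplex.finite_cells_of_finite (C := K)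
  induction hN : {c : Σ n, cell K n | (openCell (C := K) c.1 c.2 ∩ S).Nonempty}.ncard
    using Nat.strong_induction_on generalizing S with
  | _ N ih =>
    subst hN
    set T := {c : Σ n, cell K n | (openCell (C := K) c.1 c.2 ∩ S).Nonempty} with hT
    rcases T.eq_empty_or_nonempty with h | h
    · have : S = ∅ := by
        rw [hS.eq_iUnion]
        simp only [iUnion_eq_empty]
        exact fun c hc => absurd (show c ∈ T from hc) (h ▸ notMem_empty c)
      rw [this]
      exact isNbhdExtensor_empty
    obtain ⟨c, hcT, hmax⟩ := T.toFinite.exists_maximalFor (fun c => c.1) T h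
    set S₁ := ⋃ c' : {c' : Σ n, cell K n // c' ∈ T ∧ c' ≠ c},
      closedCell (C := K) c'.1.1 c'.1.2 with hS₁
    have hsub : IsSubcomplex K S₁ :=
      IsSubcomplex.iUnion fun c' => hK.isSubcomplex_closedCell _ _
    have hcell := hK.isSubcomplex_closedCell c.1 c.2
    have hS₁S : S₁ ⊆ S := iUnion_subset fun c' => hS.2 _ _ c'.2.1
    have hSeq : S = S₁ ∪ closedCell (C := K) c.1 c.2 := by
      apply subset_antisymm
      · intro x hx
        rw [hS.eq_iUnion] at hx
        simp only [mem_iUnion] at hx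
        obtain ⟨c', hc', hx⟩ := hx
        by_cases hcc : c' = c
        · subst hcc; exact .inr hx
        · exact .inl (mem_iUnion.2 ⟨⟨c', hc', hcc⟩, hx⟩)
      · exact union_subset hS₁S (hS.2 _ _ hcT)
    have hnot : ¬ (openCell (C := K) c.1 c.2 ∩ S₁).Nonempty := by
      rw [hS₁, inter_iUnion, nonempty_iUnion]
      rintro ⟨⟨c', hc', hne⟩, h⟩
      have := dim_lt_of_closedCell_subset hne.symm h
      exact absurd (hmax hc' this.le) (not_le.2 this)
    have hlt : ∀ R : Set X, R ⊆ S₁ →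
        {c : Σ n, cell K n | (openCell (C := K) c.1 c.2 ∩ R).Nonempty}.ncard < T.ncard := by
      intro R hR
      refine ncard_lt_ncard ⟨fun d hd => ?_, fun h => ?_⟩ T.toFinite
      · exact hd.mono (inter_subset_inter_right _ (hR.trans hS₁S))
      · exact hnot ((h hcT).mono (inter_subset_inter_right _ hR))
    rw [hSeq]
    obtain ⟨χ, -⟩ := hK.exists_ballChart c.1 c.2
    exact IsNbhdExtensor.union hsub.isClosed isClosed_closedCell
      (ih _ (hlt _ subset_rfl) hsub rfl) χ.isNbhdExtensor
      (ih _ (hlt _ inter_subset_left) (hsub.inter hcell) rfl)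

end Subcomplex

section Homotopy

variable {X : Type*} [TopologicalSpace X] {n : ℕ} {A Y D : Set X}

open Classical in
/-- A contractible neighbourhood extensor inside a ball is a retract of the ball. -/
theorem BallChart.exists_retraction (c : BallChart n D) (hA : IsClosed A) (hAD : A ⊆ D)
    [ContractibleSpace A] (he : IsNbhdExtensor ((Fin n → ℝ) × ℝ) A) :
    ∃ ρ : (Fin n → ℝ) → X, ContinuousOn ρ (closedBall 0 1) ∧ MapsTo ρ (closedBall 0 1) A ∧
      ∀ x ∈ A, ρ (c.invFun x) = x := by
  obtain ⟨a, ⟨H⟩⟩ := id_nullhomotopic A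
  set A' : Set (Fin n → ℝ) := closedBall 0 1 ∩ c.toFun ⁻¹' A with hA'
  have hA'c : IsClosed A' := c.continuousOn_toFun.preimage_isClosed_of_isClosed isClosed_closedBall hA
  have hA'k : IsCompact A' := (isCompact_closedBall _ _).of_isClosed_subset hA'c inter_subset_left
  let q : (Fin n → ℝ) → A := fun v => if h : c.toFun v ∈ A then ⟨c.toFun v, h⟩ else a
  have hq : ∀ v ∈ A', (q v : X) = c.toFun v := fun v hv => by
    simp only [q, dif_pos (show c.toFun v ∈ A from hv.2)]
  have hqc : ContinuousOn q A' := by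
    rw [Topology.IsInducing.subtypeVal.continuousOn_iff]
    exact (c.continuousOn_toFun.mono inter_subset_left).congr hq
  let φ : (Fin n → ℝ) × ℝ → X := fun p => (H (projIcc 0 1 zero_le_one p.2, q p.1) : A)
  have hφ : ContinuousOn φ (A' ×ˢ Icc (0 : ℝ) 1) := by
    refine continuous_subtype_val.comp_continuousOn (H.continuous.comp_continuousOn ?_)
    exact (continuous_projIcc.comp continuous_snd).continuousOn.prodMk
      (hqc.comp continuousOn_fst fun p hp => hp.1)
  have hφ1 : ∀ v, φ (v, 1) = a := fun v => by
    have : projIcc (0 : ℝ) 1 zero_le_one 1 = 1 := projIcc_right _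
    simp only [φ, this]
    simp
  have hφ0 : ∀ v ∈ A', φ (v, 0) = c.toFun v := fun v hv => by
    have : projIcc (0 : ℝ) 1 zero_le_one 0 = 0 := projIcc_left _
    simp only [φ, this]
    simpa using hq v hv
  obtain ⟨U, ψ, hU, hZU, hVU, hψ, hψA, he₁, he₂⟩ := he.exists_extension_union
    (hA'c.prod isClosed_Icc) ((isClosed_closedBall (x := (0 : Fin n → ℝ)) (ε := 1)).prod
      (isClosed_singleton (x := (1 : ℝ)))) hφ
    (continuousOn_const (c := (a : X))) (fun p _ => Subtype.coe_prop _) (fun p _ => a.2)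
    (by rintro ⟨v, t⟩ ⟨-, -, ht⟩; obtain rfl : t = 1 := ht; exact hφ1 v)
  obtain ⟨V, I, hV, -, hAV, hI, hVI⟩ := generalized_tube_lemma hA'k
    (isCompact_Icc (a := (0 : ℝ)) (b := 1)) hU hZU
  obtain ⟨u, hu0, hu1, hu⟩ := exists_continuous_zero_one_of_isClosed hA'c hV.isClosed_compl
    (disjoint_compl_right_iff_subset.2 hAV)
  have hmem : ∀ v ∈ closedBall (0 : Fin n → ℝ) 1, (v, u v) ∈ U := by
    intro v hv
    by_cases hvV : v ∈ V
    · exact hVI ⟨hvV, hI (hu v)⟩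
    · exact hVU ⟨hv, hu1 hvV⟩
  refine ⟨fun v => ψ (v, u v), ?_, fun v hv => hψA (hmem v hv), fun x hx => ?_⟩
  · exact hψ.comp (continuous_id.prodMk u.continuous).continuousOn hmem
  · have hx' : c.invFun x ∈ A' := by
      refine ⟨c.mapsTo_invFun (hAD hx), ?_⟩
      rwa [mem_preimage, c.right_inv x (hAD hx)]
    have h0 : u (c.invFun x) = 0 := hu0 hx'
    change ψ (c.invFun x, u (c.invFun x)) = x
    rw [h0, he₁ (show (c.invFun x, (0 : ℝ)) ∈ A' ×ˢ Icc (0 : ℝ) 1 from ⟨hx', by simp⟩),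
      hφ0 _ hx', c.right_inv x (hAD hx)]

variable {S : Type*} [TopologicalSpace S]

open Classical in
/-- A map to `Y ∪ D`, where `D` is a ball, can be deformed linearly inside `D` if this does not
move points of `Y ∩ D`. -/
theorem BallChart.exists_homotopic (c : BallChart n D) (hY : IsClosed Y) (hD : IsClosed D)
    (f : C(S, ↥(Y ∪ D))) (g : S → Fin n → ℝ) (hg : ContinuousOn g {s | (f s : X) ∈ D})
    (hm : ∀ s, (f s : X) ∈ D → g s ∈ closedBall 0 1)
    (hYg : ∀ s, (f s : X) ∈ Y → (f s : X) ∈ D → g s = c.invFun (f s)) :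
    ∃ f₁ : C(S, ↥(Y ∪ D)), f.Homotopic f₁ ∧
      (∀ s, (f s : X) ∈ D → (f₁ s : X) = c.toFun (g s)) ∧
      ∀ s, (f s : X) ∉ D → (f₁ s : X) = f s := by
  let f' : unitInterval × S → X := fun p => f p.2
  have hf' : Continuous f' := by fun_prop
  let h : unitInterval × S → Fin n → ℝ :=
    fun p => (1 - (p.1 : ℝ)) • c.invFun (f p.2) + (p.1 : ℝ) • g p.2
  have hh : ContinuousOn h (f' ⁻¹' D) := by
    have h1 : ContinuousOn (fun p : unitInterval × S => c.invFun (f p.2)) (f' ⁻¹' D) :=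
      c.continuousOn_invFun.comp hf'.continuousOn fun p hp => hp
    have h2 : ContinuousOn (fun p : unitInterval × S => g p.2) (f' ⁻¹' D) :=
      hg.comp continuousOn_snd fun p hp => hp
    have h3 : Continuous fun p : unitInterval × S => (p.1 : ℝ) := by fun_prop
    exact ((continuous_const.sub h3).continuousOn.smul h1).add (h3.continuousOn.smul h2)
  have hhB : MapsTo h (f' ⁻¹' D) (closedBall 0 1) := fun p hp =>
    convex_closedBall (0 : Fin n → ℝ) 1 (c.mapsTo_invFun hp) (hm _ hp)
      (sub_nonneg.2 p.1.2.2) p.1.2.1 (by ring)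
  let F : unitInterval × S → X := (f' ⁻¹' D).piecewise (fun p => c.toFun (h p)) f'
  have hFD : ∀ p, f' p ∈ D → F p = c.toFun (h p) := fun p hp => piecewise_eq_of_mem _ _ _ hp
  have hFY : ∀ p, f' p ∉ D → F p = f' p := fun p hp => piecewise_eq_of_notMem _ _ _ hp
  have hF : Continuous F := by
    rw [← continuousOn_univ]
    refine continuousOn_piecewise_of_isClosed (hD.preimage hf') (hY.preimage hf') ?_
      hf'.continuousOn ?_ ?_
    · rw [univ_inter]
      exact c.continuousOn_toFun.comp hh hhB
    · rintro p ⟨-, hpD, hpY⟩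
      have : h p = c.invFun (f p.2) := by
        simp only [h, hYg p.2 hpY hpD, ← add_smul]
        simp
      change c.toFun (h p) = f' p
      rw [this]
      exact c.right_inv _ hpD
    · exact fun p _ => (f p.2).2.symm
  have hFm : ∀ p, F p ∈ Y ∪ D := fun p => by
    by_cases hp : f' p ∈ D
    · rw [hFD p hp]; exact .inr (c.mapsTo_toFun (hhB hp))
    · rw [hFY p hp]; exact (f p.2).2
  refine ⟨⟨fun s => ⟨F (1, s), hFm _⟩, by fun_prop⟩, ⟨⟨⟨fun p => ⟨F p, hFm p⟩, by fun_prop⟩, ?_,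
    fun s => rfl⟩⟩, fun s hs => ?_, fun s hs => hFY (1, s) hs⟩
  · intro s
    apply Subtype.ext
    change F (0, s) = f s
    by_cases hs : f' (0, s) ∈ D
    · rw [hFD _ hs]
      simpa [h] using c.right_inv _ hs
    · exact hFY _ hs
  · refine (hFD (1, s) hs).trans ?_
    simp [h]

/-- If maps to `Y` are nullhomotopic, so are maps into a larger set which factor through `Y`. -/
theorem nullhomotopic_of_forall_mem {T : Set X} (hYT : Y ⊆ T)
    (hY : ∀ f : C(S, Y), f.Nullhomotopic) (f : C(S, T)) (hf : ∀ s, (f s : X) ∈ Y) :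
    f.Nullhomotopic :=
  (hY ⟨fun s => ⟨f s, hf s⟩, by fun_prop⟩).comp_right ⟨inclusion hYT, continuous_inclusion hYT⟩

theorem nullhomotopic_of_homotopic {T : Type*} [TopologicalSpace T] {f g : C(S, T)}
    (h : f.Homotopic g) (hg : g.Nullhomotopic) : f.Nullhomotopic :=
  let ⟨y, hy⟩ := hg
  ⟨y, h.trans hy⟩

/-- Attaching a ball along a contractible neighbourhood extensor. -/
theorem BallChart.nullhomotopic_union_of_contractible (c : BallChart n D) (hY : IsClosed Y)
    (hD : IsClosed D) [ContractibleSpace ↥(Y ∩ D)]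
    (he : IsNbhdExtensor ((Fin n → ℝ) × ℝ) (Y ∩ D))
    (hS : ∀ f : C(S, Y), f.Nullhomotopic) (f : C(S, ↥(Y ∪ D))) : f.Nullhomotopic := by
  obtain ⟨ρ, hρ, hρA, hρx⟩ := c.exists_retraction (hY.inter hD) inter_subset_right he
  have hρD : ∀ s, (f s : X) ∈ D → ρ (c.invFun (f s)) ∈ Y ∩ D :=
    fun s hs => hρA (c.mapsTo_invFun hs)
  obtain ⟨f₁, hf, hfD, hfY⟩ := c.exists_homotopic hY hD f (fun s => c.invFun (ρ (c.invFun (f s))))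
    (c.continuousOn_invFun.comp (hρ.comp (c.continuousOn_invFun.comp
        (continuous_subtype_val.comp f.continuous).continuousOn fun s hs => hs)
        fun s hs => c.mapsTo_invFun hs) fun s hs => (hρD s hs).2)
    (fun s hs => c.mapsTo_invFun (hρD s hs).2)
    (fun s hsY hsD => by simp only [hρx _ ⟨hsY, hsD⟩])
  refine nullhomotopic_of_homotopic hf
    (nullhomotopic_of_forall_mem subset_union_left hS f₁ fun s => ?_)
  by_cases hs : (f s : X) ∈ D
  · rw [hfD s hs, c.right_inv _ (hρD s hs).2]; exact (hρD s hs).1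
  · rw [hfY s hs]; exact (f s).2.resolve_right hs

theorem BallChart.norm_invFun (c : BallChart n D) {x : X} (hx : x ∈ c.toFun '' sphere 0 1) :
    ‖c.invFun x‖ = 1 := by
  obtain ⟨v, hv, rfl⟩ := hx
  rw [c.left_inv v (sphere_subset_closedBall hv)]
  simpa using hv

/-- Attaching a ball along its whole boundary: maps missing the centre of the ball. -/
theorem BallChart.nullhomotopic_union_of_ne_zero (c : BallChart n D) (hY : IsClosed Y)
    (hD : IsClosed D) (hYD : Y ∩ D = c.toFun '' sphere 0 1)
    (hS : ∀ f : C(S, Y), f.Nullhomotopic) (f : C(S, ↥(Y ∪ D)))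
    (hf : ∀ s, (f s : X) ∈ D → c.invFun (f s) ≠ 0) : f.Nullhomotopic := by
  have hc : ContinuousOn (fun s => c.invFun (f s)) {s | (f s : X) ∈ D} :=
    c.continuousOn_invFun.comp (continuous_subtype_val.comp f.continuous).continuousOn fun s hs => hs
  have hn : ∀ s, (f s : X) ∈ D → ‖‖c.invFun (f s)‖⁻¹ • c.invFun (f s)‖ = 1 := fun s hs => by
    rw [norm_smul, norm_inv, norm_norm, inv_mul_cancel₀ (norm_ne_zero_iff.2 (hf s hs))]
  obtain ⟨f₁, hff₁, hfD, hfY⟩ := c.exists_homotopic hY hD f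
    (fun s => ‖c.invFun (f s)‖⁻¹ • c.invFun (f s))
    ((hc.norm.inv₀ fun s hs => norm_ne_zero_iff.2 (hf s hs)).smul hc)
    (fun s hs => by rw [mem_closedBall_zero_iff, hn s hs])
    (fun s hsY hsD => by simp [c.norm_invFun (hYD.subset ⟨hsY, hsD⟩)])
  refine nullhomotopic_of_homotopic hff₁
    (nullhomotopic_of_forall_mem subset_union_left hS f₁ fun s => ?_)
  by_cases hs : (f s : X) ∈ D
  · have : (f₁ s : X) ∈ Y ∩ D := by
      rw [hYD, hfD s hs]
      exact mem_image_of_mem _ (by simpa using hn s hs)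
    exact this.1
  · rw [hfY s hs]; exact (f s).2.resolve_right hs

/-- A smooth image of the `i`-sphere in a space of dimension greater than `i` has dense
complement. -/
theorem dense_compl_image_sphere {i n : ℕ} (hin : i < n)
    {g : EuclideanSpace ℝ (Fin (i + 1)) → Fin n → ℝ} (hg : ContDiff ℝ 1 g) :
    Dense (g '' sphere 0 1)ᶜ := by
  obtain ⟨v, hv⟩ : (sphere (0 : EuclideanSpace ℝ (Fin (i + 1))) 1).Nonempty :=
    NormedSpace.sphere_nonempty.2 zero_le_one
  have hv' : ‖v‖ = 1 := by simpa using hv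
  have : Fact (Module.finrank ℝ (EuclideanSpace ℝ (Fin (i + 1))) = i + 1) := ⟨by simp⟩
  have hrank : Module.finrank ℝ (ℝ ∙ v)ᗮ = i :=
    Submodule.finrank_orthogonal_span_singleton (by rintro rfl; simp at hv')
  have hsub : g '' sphere 0 1 ⊆
      {g v} ∪ range (fun w : (ℝ ∙ v)ᗮ => g (stereoInvFunAux v w)) := by
    rintro _ ⟨x, hx, rfl⟩
    by_cases hxv : x = v
    · exact .inl (by rw [hxv]; rfl)
    · refine .inr ⟨stereoToFun v x, ?_⟩
      have := congrArg Subtype.val (stereo_left_inv hv' (x := ⟨x, hx⟩) hxv)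
      exact congrArg g this
  have hcd : ContDiff ℝ 1 (fun w : (ℝ ∙ v)ᗮ => g (stereoInvFunAux v w)) :=
    hg.comp (contDiff_stereoInvFunAux.comp (ℝ ∙ v)ᗮ.subtypeL.contDiff)
  refine dense_compl_of_dimH_lt_finrank (lt_of_le_of_lt (dimH_mono hsub) ?_)
  rw [dimH_union, dimH_singleton, Module.finrank_fin_fun, max_lt_iff]
  refine ⟨by exact_mod_cast (Nat.zero_le i).trans_lt hin, hcd.dimH_range_le.trans_lt ?_⟩
  rw [hrank]
  exact_mod_cast hin

/-- A map from the `i`-sphere to `Y ∪ D`, with `D` a ball of dimension greater than `i`, can be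
pushed off the centre of the ball. -/
theorem BallChart.exists_homotopic_ne_zero {i : ℕ} (hin : i < n) (c : BallChart n D)
    (hY : IsClosed Y) (hD : IsClosed D) (hYD : Y ∩ D ⊆ c.toFun '' sphere 0 1)
    (f : C(sphere (0 : EuclideanSpace ℝ (Fin (i + 1))) 1, ↥(Y ∪ D))) :
    ∃ f₁ : C(sphere (0 : EuclideanSpace ℝ (Fin (i + 1))) 1, ↥(Y ∪ D)), f.Homotopic f₁ ∧
      ∀ s, (f₁ s : X) ∈ D → c.invFun (f₁ s) ≠ 0 := by
  have hfX : Continuous fun s => (f s : X) := by fun_prop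
  obtain ⟨G, hGB, hG⟩ := exists_continuous_extension_closedBall (hD.preimage hfX)
    (c.continuousOn_invFun.comp hfX.continuousOn fun s hs => hs) (fun s hs => c.mapsTo_invFun hs)
  obtain ⟨G', hG'⟩ := ContinuousMap.exists_restrict_eq isClosed_sphere G
  obtain ⟨p, hp, hpG, -⟩ := G'.continuous.exists_contDiff_approx 1
    (continuous_const (y := (1 / 8 : ℝ))) (fun _ => by norm_num)
  obtain ⟨q, hq, hqn⟩ := (dense_compl_image_sphere hin hp).exists_mem_open isOpen_ball
    ⟨(0 : Fin n → ℝ), mem_ball_self (show (0 : ℝ) < 1 / 8 by norm_num)⟩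
  rw [mem_ball_zero_iff] at hqn
  have hd : ∀ s : sphere (0 : EuclideanSpace ℝ (Fin (i + 1))) 1, ‖p s - q - G s‖ ≤ 1 / 4 := by
    intro s
    have h1 := hpG s
    have h2 : G' s = G s := DFunLike.congr_fun hG' s
    rw [h2, dist_eq_norm] at h1
    calc ‖p s - q - G s‖ = ‖(p s - G s) - q‖ := by congr 1; abel
      _ ≤ ‖p s - G s‖ + ‖q‖ := norm_sub_le _ _
      _ ≤ 1 / 4 := by linarith
  let u : (Fin n → ℝ) → ℝ := fun v => max 0 (min 1 (3 - 4 * ‖v‖))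
  have hu : Continuous u := by fun_prop
  have hu0 : ∀ v, 0 ≤ u v := fun v => le_max_left _ _
  have hu1 : ∀ v, u v ≤ 1 := fun v => max_le zero_le_one (min_le_left _ _)
  have hud : ∀ s, ‖u (G s) • (p s - q - G s)‖ ≤ 1 / 4 := fun s => by
    rw [norm_smul, Real.norm_of_nonneg (hu0 _)]
    exact (mul_le_of_le_one_left (norm_nonneg _) (hu1 _)).trans (hd s)
  have huz : ∀ v, 3 / 4 ≤ ‖v‖ → u v = 0 := fun v hv =>
    max_eq_left ((min_le_right _ _).trans (by linarith))
  have huo : ∀ v, ‖v‖ ≤ 1 / 2 → u v = 1 := fun v hv => by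
    simp only [u]
    rw [min_eq_left (by linarith), max_eq_right zero_le_one]
  have hpc : Continuous p := hp.continuous
  obtain ⟨f₁, hff₁, hfD, hfY⟩ := c.exists_homotopic hY hD f
    (fun s => G s + u (G s) • (p s - q - G s)) (Continuous.continuousOn (by fun_prop))
    (fun s hs => by
      rw [mem_closedBall_zero_iff]
      rcases le_total (3 / 4) ‖G s‖ with h | h
      · simpa [huz _ h] using hGB s
      · exact (norm_add_le _ _).trans (by linarith [hud s]))
    (fun s hsY hsD => by
      have h1 : G s = c.invFun (f s) := hG hsD
      have h2 : ‖G s‖ = 1 := by rw [h1, c.norm_invFun (hYD ⟨hsY, hsD⟩)]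
      rw [huz _ (by rw [h2]; norm_num), zero_smul, add_zero, h1])
  refine ⟨f₁, hff₁, fun s hs => ?_⟩
  by_cases hsD : (f s : X) ∈ D
  · rw [hfD s hsD, c.left_inv]
    · intro h0
      rcases le_total ‖G s‖ (1 / 2) with h | h
      · rw [huo _ h, one_smul, add_sub_cancel, sub_eq_zero] at h0
        exact hq ⟨s, s.2, h0⟩
      · have h1 := norm_sub_le (G s + u (G s) • (p s - q - G s)) (u (G s) • (p s - q - G s))
        rw [add_sub_cancel_right, h0, norm_zero] at h1
        linarith [hud s]
    · rw [mem_closedBall_zero_iff]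
      rcases le_total (3 / 4) ‖G s‖ with h | h
      · simpa [huz _ h] using hGB s
      · exact (norm_add_le _ _).trans (by linarith [hud s])
  · rw [hfY s hsD] at hs
    exact absurd hs hsD

/-- Attaching a ball along its whole boundary. -/
theorem BallChart.nullhomotopic_union_of_sphere {i : ℕ} (hin : i < n) (c : BallChart n D)
    (hY : IsClosed Y) (hD : IsClosed D) (hYD : Y ∩ D = c.toFun '' sphere 0 1)
    (hS : ∀ f : C(sphere (0 : EuclideanSpace ℝ (Fin (i + 1))) 1, Y), f.Nullhomotopic)
    (f : C(sphere (0 : EuclideanSpace ℝ (Fin (i + 1))) 1, ↥(Y ∪ D))) : f.Nullhomotopic := by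
  obtain ⟨f₁, hf, hf₁⟩ := c.exists_homotopic_ne_zero hin hY hD hYD.subset f
  exact nullhomotopic_of_homotopic hf (c.nullhomotopic_union_of_ne_zero hY hD hYD hS f₁ hf₁)

/-- A ball is contractible. -/
theorem BallChart.nullhomotopic (c : BallChart n D) (f : C(S, D)) :
    f.Nullhomotopic := by
  have hc : Continuous fun s => c.invFun (f s) :=
    c.continuousOn_invFun.comp_continuous (by fun_prop) fun s => (f s).2
  have hm : ∀ p : unitInterval × S,
      (1 - (p.1 : ℝ)) • c.invFun (f p.2) ∈ closedBall (0 : Fin n → ℝ) 1 := fun p => by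
    have h1 := c.mapsTo_invFun (f p.2).2
    rw [mem_closedBall_zero_iff] at h1 ⊢
    rw [norm_smul, Real.norm_of_nonneg (sub_nonneg.2 p.1.2.2)]
    exact mul_le_one₀ (by linarith [p.1.2.1]) (norm_nonneg _) h1
  refine ⟨⟨c.toFun 0, c.mapsTo_toFun (by simp)⟩, ⟨⟨⟨fun p => ⟨c.toFun
    ((1 - (p.1 : ℝ)) • c.invFun (f p.2)), c.mapsTo_toFun (hm p)⟩, ?_⟩, ?_, ?_⟩⟩⟩
  · exact (c.continuousOn_toFun.comp_continuous
      (((continuous_const.sub (continuous_subtype_val.comp continuous_fst)).smul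
        (hc.comp continuous_snd))) hm).subtype_mk _
  · intro s
    apply Subtype.ext
    simpa using c.right_inv _ (f s).2
  · intro s
    apply Subtype.ext
    simp

/-- A nullhomotopic map on the sphere extends to the ball. -/
theorem exists_extension_of_nullhomotopic {T : Type*} [TopologicalSpace T] {i : ℕ}
    {f : C(sphere (0 : EuclideanSpace ℝ (Fin (i + 1))) 1, T)} (hf : f.Nullhomotopic) :
    ∃ g : C(closedBall (0 : EuclideanSpace ℝ (Fin (i + 1))) 1, T),
      ∀ x : sphere (0 : EuclideanSpace ℝ (Fin (i + 1))) 1,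
        g ⟨x, sphere_subset_closedBall x.2⟩ = f x := by
  obtain ⟨y, ⟨H⟩⟩ := hf
  have hm : ∀ p : unitInterval × sphere (0 : EuclideanSpace ℝ (Fin (i + 1))) 1,
      ‖(1 - (p.1 : ℝ)) • (p.2 : EuclideanSpace ℝ (Fin (i + 1)))‖ = 1 - (p.1 : ℝ) := fun p => by
    rw [norm_smul, norm_eq_of_mem_sphere, mul_one, Real.norm_of_nonneg (sub_nonneg.2 p.1.2.2)]
  let π : C(unitInterval × sphere (0 : EuclideanSpace ℝ (Fin (i + 1))) 1,
      closedBall (0 : EuclideanSpace ℝ (Fin (i + 1))) 1) :=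
    ⟨fun p => ⟨(1 - (p.1 : ℝ)) • (p.2 : EuclideanSpace ℝ (Fin (i + 1))), by
      rw [mem_closedBall_zero_iff, hm]; linarith [p.1.2.1]⟩, by fun_prop⟩
  obtain ⟨v, hv⟩ : (sphere (0 : EuclideanSpace ℝ (Fin (i + 1))) 1).Nonempty :=
    NormedSpace.sphere_nonempty.2 zero_le_one
  have hπs : Function.Surjective π := by
    rintro ⟨x, hx⟩
    rw [mem_closedBall_zero_iff] at hx
    by_cases hx0 : x = 0
    · exact ⟨(1, ⟨v, hv⟩), Subtype.ext (by simp [π, hx0])⟩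
    · have hn : ‖x‖ ≠ 0 := norm_ne_zero_iff.2 hx0
      refine ⟨(⟨1 - ‖x‖, by linarith, by linarith [norm_nonneg x]⟩,
        ⟨‖x‖⁻¹ • x, by simp [norm_smul, hn]⟩), Subtype.ext ?_⟩
      simp [π, smul_smul, hn]
  have hπ : Topology.IsQuotientMap π := .of_surjective_continuous hπs π.continuous
  have hfac : Function.FactorsThrough H.toContinuousMap π := by
    intro p p' hpp
    have hv : (1 - (p.1 : ℝ)) • (p.2 : EuclideanSpace ℝ (Fin (i + 1))) =
      (1 - (p'.1 : ℝ)) • (p'.2 : EuclideanSpace ℝ (Fin (i + 1))) := congrArg Subtype.val hpp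
    have ht : p.1 = p'.1 := by
      have := hm p
      rw [hv, hm p'] at this
      exact Subtype.ext (by linarith)
    obtain ⟨t, x⟩ := p
    obtain ⟨t', x'⟩ := p'
    obtain rfl : t = t' := ht
    by_cases h1 : t = 1
    · subst h1
      exact (H.apply_one x).trans (H.apply_one x').symm
    · have : (1 - (t : ℝ)) ≠ 0 := fun h => h1 (Subtype.ext (by simpa using (sub_eq_zero.1 h).symm))
      rw [show x = x' from Subtype.ext (smul_right_injective _ this hv)]
  refine ⟨hπ.lift H.toContinuousMap hfac, fun x => ?_⟩
  have h0 : π (0, x) = ⟨x, sphere_subset_closedBall x.2⟩ := Subtype.ext (by simp [π])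
  rw [← h0]
  exact (DFunLike.congr_fun (hπ.lift_comp H.toContinuousMap hfac) (0, x)).trans (H.apply_zero x)

end Homotopy

section Shelling

open Topology.CWComplex

variable {X : Type*} [TopologicalSpace X] {K : Set X} [Topology.CWComplex K]

/-- The union of the first `m` cells of an ordering of the maximal cells. -/
def initialUnion {k : ℕ} (C : Fin k ≃ MaximalCell K) (m : ℕ) : Set X :=
  ⋃ i : Fin k, ⋃ _ : (i : ℕ) < m, (C i).closed

theorem initialUnion_succ {k : ℕ} (C : Fin k ≃ MaximalCell K) (j : Fin k) :
    initialUnion C (j + 1) = initialUnion C j ∪ (C j).closed := by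
  ext x
  simp only [initialUnion, mem_iUnion, mem_union, exists_prop]
  constructor
  · rintro ⟨i, hi, hx⟩
    rcases Nat.lt_succ_iff_lt_or_eq.1 hi with h | h
    · exact .inl ⟨i, h, hx⟩
    · obtain rfl := Fin.ext h
      exact .inr hx
  · rintro (⟨i, hi, hx⟩ | hx)
    · exact ⟨i, hi.trans (Nat.lt_succ_self _), hx⟩
    · exact ⟨j, Nat.lt_succ_self _, hx⟩

variable [T2Space X]

theorem IsRegular.isSubcomplex_initialUnion (hK : IsRegular K) {k : ℕ}
    (C : Fin k ≃ MaximalCell K) (m : ℕ) : IsSubcomplex K (initialUnion C m) :=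
  IsSubcomplex.iUnion fun _ => IsSubcomplex.iUnion fun _ => hK.isSubcomplex_closedCell _ _

variable [Topology.RelCWComplex.Finite K]

/-- Every point of a finite complex lies in a maximal closed cell. -/
theorem exists_mem_closed_maximalCell {x : X} (hx : x ∈ K) : ∃ e : MaximalCell K, x ∈ e.closed := by
  have := Topology.RelCWComplex.finite_cells_of_finite (C := K)
  rw [← Topology.CWComplex.union (C := K)] at hx
  simp only [mem_iUnion] at hx
  obtain ⟨n, e, hx⟩ := hx
  obtain ⟨c, hc, hmax⟩ := (toFinite {c : Σ n, cell K n | x ∈ closedCell (C := K) c.1 c.2}).exists_maximalFor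
    (fun c => c.1) _ ⟨⟨n, e⟩, hx⟩
  refine ⟨⟨c, fun c' hc' => ?_⟩, hc⟩
  by_contra hne
  have hlt : c.1 < c'.1 := dim_lt_of_closedCell_subset (Ne.symm hne)
    ⟨_, map_zero_mem_openCell c.1 c.2, hc' (map_zero_mem_closedCell c.1 c.2)⟩
  exact absurd (hmax (hc' hc) hlt.le) (not_le.2 hlt)

theorem initialUnion_eq {k : ℕ} (C : Fin k ≃ MaximalCell K) : initialUnion C k = K := by
  apply subset_antisymm
  · exact iUnion₂_subset fun i _ => closedCell_subset_complex _ _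
  · intro x hx
    obtain ⟨e, he⟩ := exists_mem_closed_maximalCell hx
    refine mem_iUnion₂.2 ⟨C.symm e, (C.symm e).2, ?_⟩
    rwa [C.apply_symm_apply]

/-- Low-dimensional spheres in the initial unions of a shelling are nullhomotopic. -/
theorem IsTopologicalShelling.nullhomotopic (hK : IsRegular K) {n k : ℕ}
    {C : Fin k ≃ MaximalCell K} (hC : IsTopologicalShelling C) (hn : ∀ e : MaximalCell K, e.dim = n)
    {i : ℕ} (hin : i < n) {m : ℕ} (hm : 1 ≤ m) (hmk : m ≤ k)
    (f : C(sphere (0 : EuclideanSpace ℝ (Fin (i + 1))) 1, initialUnion C m)) :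
    f.Nullhomotopic := by
  induction m, hm using Nat.le_induction with
  | base =>
    obtain ⟨c, -⟩ := hK.exists_ballChart _ (C ⟨0, hmk⟩).1.2
    have h : initialUnion C 1 = (C ⟨0, hmk⟩).closed := by
      have := initialUnion_succ C ⟨0, hmk⟩
      simpa [initialUnion] using this
    revert f
    rw [h]
    exact fun f => BallChart.nullhomotopic c f
  | succ m hm ih =>
    let j : Fin k := ⟨m, hmk⟩
    obtain ⟨c, hc⟩ := hK.exists_ballChart _ (C j).1.2
    have hY := hK.isSubcomplex_initialUnion C m
    have hD : IsSubcomplex K (C j).closed := hK.isSubcomplex_closedCell _ _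
    have hS := ih (Nat.le_of_succ_le hmk)
    have h := initialUnion_succ C j
    revert f
    change ∀ f : C(_, initialUnion C (j + 1)), _
    rw [h]
    intro f
    rcases hC.2 j hm with ⟨-, hA⟩ | hA
    · have : ContractibleSpace ↥(initialUnion C m ∩ closedCell (C j).1.1 (C j).1.2) := hA
      exact c.nullhomotopic_union_of_contractible hY.isClosed hD.isClosed
        ((hY.inter hD).isNbhdExtensor hK) hS f
    · have hi : i < (C j).1.1 := hin.trans_eq (hn (C j)).symm
      refine c.nullhomotopic_union_of_sphere hi hY.isClosed hD.isClosed ?_ hS f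
      rw [hc]
      exact hA

end Shelling

end CellShelling

theorem mainTheorem6 {X : Type*} [TopologicalSpace X] [T2Space X] (K : Set X)
    [Topology.CWComplex K] [Topology.RelCWComplex.Finite K]
    (hreg : CellShelling.IsRegular K)
    (n : ℕ) (hpure : CellShelling.IsPureOfDim K n)
    (hshell : CellShelling.AdmitsTopologicalShelling K) :
    CellShelling.IsKConnected ((n : ℤ) - 1) K := by
  obtain ⟨k, C, hC⟩ := hshell
  obtain ⟨⟨e⟩, hn⟩ := hpure
  have hx : Topology.CWComplex.map (C := K) n e 0 ∈ K :=
    Topology.CWComplex.closedCell_subset_complex n e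
      (Topology.CWComplex.map_zero_mem_closedCell n e)
  refine ⟨fun _ => ⟨⟨_, hx⟩⟩, fun i hi f => CellShelling.exists_extension_of_nullhomotopic ?_⟩
  obtain ⟨e', -⟩ := CellShelling.exists_mem_closed_maximalCell hx
  have hk : 1 ≤ k := Nat.one_le_iff_ne_zero.2 fun h => by
    subst h
    exact (C.symm e').elim0
  have key : ∀ f : C(sphere (0 : EuclideanSpace ℝ (Fin (i + 1))) 1,
      CellShelling.initialUnion C k), f.Nullhomotopic :=
    hC.nullhomotopic hreg hn (by omega) hk le_rfl
  rw [CellShelling.initialUnion_eq] at key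
  exact key f
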